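/- Let $n \ge 0$ and write $[n] := \{1,\dots,n\}$. Let $\lambda = (\lambda_1 \ge \dots \ge \lambda_n \ge 0)$ be a partition, and let $q_1 < \dots < q_r$ be the distinct column lengths of its shape that are less than $n$; set $q_0 := 0$ and $q_{r+1} := n$. The intervals $(q_{h-1}, q_h] = \{q_{h-1}+1, \dots, q_h\}$, $1 \le h \le r+1$, are called carrels. Let $\beta = (\beta_1,\dots,\beta_n)$ be an upper $\lambda$-tuple, i.e. $\beta_i \in [n]$ and $\beta_i \ge i$ for all $i \in [n]$. The critical indices of $\beta$ in the carrel $(q_{h-1}, q_h]$ are defined from right to left: the first is $x_1 := q_h$; given $x_{u-1}$, the next is the maximal $x_u$ with $q_{h-1} < x_u < x_{u-1}$ and $\beta_{x_{u-1}} - \beta_{x_u} > x_{u-1} - x_u$, if such an index exists; otherwise the process stops. The $\lambda$-core of $\beta$ is the $n$-tuple $\delta = \Delta_\lambda(\beta)$ with $\delta_i := \beta_x - (x - i)$, where $x = x(i)$ is the smallest critical index with $x \ge i$. The upper $\lambda$-tuple $\beta$ is a gapless core $\lambda$-tuple if for every $1 \le h \le r$ one has $\beta_{q_h} \le \beta_k$,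 where $k$ is the leftmost critical index of $\beta$ in the carrel $(q_h, q_{h+1}]$. Let $s_\lambda(\beta;x) := \sum_T x^{\Theta(T)}$, summed over the semistandard tableaux $T$ of shape $\lambda$ with values in $[n]$ (rows weakly, columns strictly increasing) whose values in row $i$ are at most $\beta_i$ for every $i$; here $x^{\Theta(T)} := \prod_{k=1}^n x_k^{\theta_k}$, where $\theta_k$ is the number of values of $T$ equal to $k$. For $u \in \mathbb{Z}$ and $i, k \in [n]$ let $h_u(i,k;x)$ be the complete homogeneous symmetric polynomial $\sum_{i \le t_1 \le \dots \le t_u \le k} x_{t_1} \cdots x_{t_u}$ in the variables $x_i, \dots, x_k$ if $u \ge 0$, and $h_u(i,k;x) := 0$ if $u < 0$. If $\beta$ is a gapless core $\lambda$-tuple and $\delta = \Delta_\lambda(\beta)$, then $$ s_\lambda(\beta;x) = \det\bigl( h_{\lambda_j - j + i}(i, \delta_j; x) \bigr)_{i,j=1}^n $$ in $\mathbb{Z}[x_1,\dots,x_n]$. (It is not required that $\beta$ be bounded by its platform, i.e. that $\beta_i \le \beta_{x(i)}$ for all $i$.) -/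

import Mathlib

/-! All indices, tuple entries, tableau values and variables are `0`-based: `i : Fin n` stands for
the index, entry, value or variable subscript `i + 1` of `{1, …, n}`. A set `R` of dividers is a set
of natural numbers, `q ∈ R` separating the first `q` indices (those with `i < q`) from the rest. -/

namespace RowBound

/-! ### Tuples with dividers, critical indices, cores -/

section Tuples

variable {n : ℕ}

/-- Upper tuple: every entry is at least its index. -/
def IsUpper (β : Fin n → Fin n) : Prop := ∀ i, i ≤ β i

/-- `x` is the last index of its carrel, i.e. there is a divider directly after it (there is always
one after the last index). -/
def IsCarrelEnd (R : Finset ℕ) (x : Fin n) : Prop := (x : ℕ) + 1 ∈ R ∨ (x : ℕ) + 1 = n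

/-- For `i ≤ j`: no divider stands between `i` and `j`. -/
def SameCarrel (R : Finset ℕ) (i j : Fin n) : Prop := ∀ q ∈ R, ¬ ((i : ℕ) < q ∧ q ≤ (j : ℕ))

/-- `x` lies to the left of `y` in the same carrel, and `β y - β x > y - x`. -/
def Drops (R : Finset ℕ) (β : Fin n → Fin n) (y x : Fin n) : Prop :=
  x < y ∧ SameCarrel R x y ∧ ((y : ℕ) : ℤ) - ((x : ℕ) : ℤ) < ((β y : ℕ) : ℤ) - ((β x : ℕ) : ℤ)

/-- Critical indices: in each carrel the rightmost index is critical, and the next critical index to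
the left of a critical index `y` is the maximal `x` with `Drops R β y x`, if there is one. -/
inductive IsCritical (R : Finset ℕ) (β : Fin n → Fin n) : Fin n → Prop
  | rightmost (x : Fin n) (hx : IsCarrelEnd R x) : IsCritical R β x
  | next (y x : Fin n) (hy : IsCritical R β y) (hx : Drops R β y x)
      (hmax : ∀ z, Drops R β y z → z ≤ x) : IsCritical R β x

open Classical in
/-- The critical indices that are at least `i`. -/
noncomputable def criticalFrom (R : Finset ℕ) (β : Fin n → Fin n) (i : Fin n) : Finset (Fin n) :=
  Finset.univ.filter fun x => i ≤ x ∧ IsCritical R β x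

theorem criticalFrom_nonempty (R : Finset ℕ) (β : Fin n → Fin n) (i : Fin n) :
    (criticalFrom R β i).Nonempty := by
  have hn : 0 < n := i.pos
  refine ⟨⟨n - 1, by omega⟩, ?_⟩
  simp only [criticalFrom, Finset.mem_filter, Finset.mem_univ, true_and]
  refine ⟨?_, IsCritical.rightmost _ (Or.inr ?_)⟩
  · rw [Fin.le_def]
    change (i : ℕ) ≤ n - 1
    omega
  · change n - 1 + 1 = n
    omega

/-- The smallest critical index that is at least `i`; it lies in the carrel of `i`, because the last
index of that carrel is critical. -/
noncomputable def nextCritical (R : Finset ℕ) (β : Fin n → Fin n) (i : Fin n) : Fin n :=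
  (criticalFrom R β i).min' (criticalFrom_nonempty R β i)

/-- The core `Δ_R(β)`: its entry at `i` is `β x - (x - i)`, where `x` is the smallest critical index
that is at least `i`. (For upper `β` the outer subtraction does not truncate.) -/
noncomputable def core (R : Finset ℕ) (β : Fin n → Fin n) (i : Fin n) : Fin n :=
  ⟨(β (nextCritical R β i) : ℕ) - ((nextCritical R β i : ℕ) - (i : ℕ)),
    lt_of_le_of_lt (Nat.sub_le _ _) (β (nextCritical R β i)).isLt⟩

/-- The critical list of `β` is a flag critical list: if the index `i` ends a carrel and `j = i + 1`
starts the next one, then the entry at `i` is at most the leftmost critical entry of the next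
carrel. -/
def HasFlagCriticalList (R : Finset ℕ) (β : Fin n → Fin n) : Prop :=
  ∀ i j : Fin n, (i : ℕ) + 1 = (j : ℕ) → (j : ℕ) ∈ R → β i ≤ β (nextCritical R β j)

/-- Gapless core `R`-tuple: an upper tuple whose critical list is a flag critical list. -/
def IsGaplessCore (R : Finset ℕ) (β : Fin n → Fin n) : Prop :=
  IsUpper β ∧ HasFlagCriticalList R β

end Tuples

/-! ### Shapes, tableaux, polynomials -/

section Shapes

variable {n : ℕ}

/-- The shape with rows of lengths `lam 0 ≥ … ≥ lam (n - 1) ≥ 0`. -/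
def shape (lam : Fin n → ℕ) (hlam : Antitone lam) : YoungDiagram :=
  YoungDiagram.ofRowLens (List.ofFn lam) hlam.sortedGE_ofFn

theorem mem_shape (lam : Fin n → ℕ) (hlam : Antitone lam) (i j : ℕ) :
    (i, j) ∈ shape lam hlam ↔ ∃ h : i < n, j < lam ⟨i, h⟩ := by
  simp [shape, YoungDiagram.mem_ofRowLens]

/-- `R_λ`: the set of the column lengths of the shape that are less than `n`. -/
def columnLengths (lam : Fin n → ℕ) (hlam : Antitone lam) : Finset ℕ :=
  ((Finset.range ((shape lam hlam).rowLen 0)).image (shape lam hlam).colLen).filter (· < n)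

/-- The semistandard tableaux of the given shape with values among the `n` allowed ones whose values
in row `i` are at most `β i`. -/
def rowBoundSet (lam : Fin n → ℕ) (hlam : Antitone lam) (β : Fin n → Fin n) :
    Set (SemistandardYoungTableau (shape lam hlam)) :=
  {T | (∀ i j : ℕ, (i, j) ∈ shape lam hlam → T i j < n) ∧
    ∀ (i : Fin n) (j : ℕ), ((i : ℕ), j) ∈ shape lam hlam → T i j ≤ (β i : ℕ)}

theorem rowBoundSet_finite (lam : Fin n → ℕ) (hlam : Antitone lam) (β : Fin n → Fin n) :
    (rowBoundSet lam hlam β).Finite := by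
  let f : rowBoundSet lam hlam β → ((shape lam hlam).cells → Fin n) :=
    fun T c => ⟨T.1 c.1.1 c.1.2, T.2.1 _ _ ((shape lam hlam).mem_cells _ |>.1 c.2)⟩
  have hf : Function.Injective f := by
    intro S T h
    apply Subtype.ext
    apply SemistandardYoungTableau.ext
    intro i j
    by_cases hij : (i, j) ∈ shape lam hlam
    · have := congrFun h ⟨(i, j), (shape lam hlam).mem_cells _ |>.2 hij⟩
      exact congrArg Fin.val this
    · rw [S.1.zeros hij, T.1.zeros hij]
  exact Set.finite_coe_iff.mp (Finite.of_injective f hf)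

/-- The monomial `x ^ Θ(T)`: the exponent of `x k` is the number of boxes of `T` with value `k`. -/
noncomputable def tableauMonomial {μ : YoungDiagram} (n : ℕ) (T : SemistandardYoungTableau μ) :
    MvPolynomial (Fin n) ℤ :=
  ∏ k : Fin n, MvPolynomial.X k ^ (μ.cells.filter fun c => T c.1 c.2 = (k : ℕ)).card

/-- The row bound sum `s_λ(β; x)`. -/
noncomputable def rowBoundSum (lam : Fin n → ℕ) (hlam : Antitone lam) (β : Fin n → Fin n) :
    MvPolynomial (Fin n) ℤ :=
  ∑ T ∈ (rowBoundSet_finite lam hlam β).toFinset, tableauMonomial n T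

/-- `h_u(i, k; x)`: the complete homogeneous symmetric polynomial of degree `u` in the variables
`x i, …, x k`, and `0` for `u < 0`. -/
noncomputable def completeHomogeneous (u : ℤ) (i k : Fin n) : MvPolynomial (Fin n) ℤ :=
  if u < 0 then 0
  else ∑ s ∈ (Finset.Icc i k).sym u.toNat,
    ((s : Multiset (Fin n)).map fun t => MvPolynomial.X t).prod

end Shapes

end RowBound

/-! Let `x(i)` be the smallest critical index that is at least `i`, and put `ψ i = β x(i)`. The
proof replaces `β` by the flag `ψ`, evaluates the flagged sum as a determinant, and transforms that
determinant into the one with the core `δ`.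

On a carrel the rows have equal length and columns increase strictly, so a bound `β x` in row `x =
x(i)` forces the bound `β x - (x - i) = δ i` in row `i`. By the choice of critical indices `δ i ≤ β
i`. Hence `β` and `ψ` bound the same tableaux (`rowBoundSet_nextCritical`), and the gapless
condition makes `ψ` weakly increasing (`monotone_entry_nextCritical`).

For a weakly increasing flag, `flagSum_eq_det` gives a determinant whose row `j` uses the variables
from the first up to the `ψ j`-th. Its proof is an induction on the largest allowed value: the boxes
containing that value form a horizontal strip, and the determinant obeys the same recursion by one
row operation and multilinearity.

Removing variables from a complete homogeneous polynomial means multiplying its generating series by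
a polynomial, that is, taking a finite combination of entries of shifted degree. From `ψ` to `δ`
these entries lie in the rows `j, …, x(j)`, where `ψ` and `lam` are constant
(`det_flagMatrix_eq_of_staircase`). Dropping the first `i` variables in column `i` combines columns
(`det_homSeries_eq_det_flagMatrix`). Both operations are unitriangular. -/

namespace RowBound

/-! ### Generating series of complete homogeneous symmetric polynomials -/

section Series

open PowerSeries

variable {A : Type*} [CommRing A]

/-- The geometric series `1 + a t + a ^ 2 t ^ 2 + …`. -/
def geomSeries (a : A) : A⟦X⟧ := PowerSeries.mk fun m => a ^ m

theorem geomSeries_eq (a : A) : geomSeries a = 1 + PowerSeries.C a * (X * geomSeries a) := by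
  ext m
  cases m with
  | zero => simp [geomSeries]
  | succ m => simp [geomSeries, coeff_succ_X_mul, coeff_one, pow_succ']

theorem geomSeries_mul (a : A) :
    (((1 - Polynomial.C a * Polynomial.X : Polynomial A)) : A⟦X⟧) * geomSeries a = 1 := by
  have h := geomSeries_eq a
  push_cast
  linear_combination h

/-- The generating series of the complete homogeneous symmetric polynomials in the `x l`,
`i ≤ l < k`. -/
noncomputable def homSeries (x : ℕ → A) (i k : ℕ) : A⟦X⟧ :=
  ∏ l ∈ Finset.Ico i k, geomSeries (x l)

/-- The inverse of `homSeries x i k`, a polynomial. -/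
noncomputable def elemPoly (x : ℕ → A) (i k : ℕ) : Polynomial A :=
  ∏ l ∈ Finset.Ico i k, (1 - Polynomial.C (x l) * Polynomial.X)

theorem elemPoly_mul_homSeries (x : ℕ → A) (i k : ℕ) :
    (elemPoly x i k : A⟦X⟧) * homSeries x i k = 1 := by
  have h : (elemPoly x i k : A⟦X⟧) = ∏ l ∈ Finset.Ico i k,
      ((1 - Polynomial.C (x l) * Polynomial.X : Polynomial A) : A⟦X⟧) :=
    map_prod (Polynomial.coeToPowerSeries.ringHom (R := A))
      (fun l => 1 - Polynomial.C (x l) * Polynomial.X) (Finset.Ico i k)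
  rw [h, homSeries, ← Finset.prod_mul_distrib]
  exact Finset.prod_eq_one fun l _ => geomSeries_mul (x l)

theorem homSeries_mul_homSeries (x : ℕ → A) {i j k : ℕ} (hij : i ≤ j) (hjk : j ≤ k) :
    homSeries x i j * homSeries x j k = homSeries x i k :=
  Finset.prod_Ico_consecutive _ hij hjk

theorem elemPoly_natDegree_le (x : ℕ → A) (i k : ℕ) : (elemPoly x i k).natDegree ≤ k - i := by
  refine (Polynomial.natDegree_prod_le _ _).trans ?_
  refine (Finset.sum_le_card_nsmul _ _ 1 fun l _ => ?_).trans (by simp)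
  compute_degree

theorem elemPoly_coeff_zero (x : ℕ → A) (i k : ℕ) : (elemPoly x i k).coeff 0 = 1 := by
  rw [elemPoly, Polynomial.coeff_zero_prod]
  simp

/-- Removing the last variables of a generating series. -/
theorem elemPoly_mul_homSeries_right (x : ℕ → A) {i j k : ℕ} (hij : i ≤ j) (hjk : j ≤ k) :
    (elemPoly x j k : A⟦X⟧) * homSeries x i k = homSeries x i j := by
  rw [← homSeries_mul_homSeries x hij hjk]
  linear_combination homSeries x i j * elemPoly_mul_homSeries x j k

/-- Removing the first variables of a generating series. -/
theorem elemPoly_mul_homSeries_left (x : ℕ → A) {i j k : ℕ} (hij : i ≤ j) (hjk : j ≤ k) :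
    (elemPoly x i j : A⟦X⟧) * homSeries x i k = homSeries x j k := by
  rw [← homSeries_mul_homSeries x hij hjk]
  linear_combination homSeries x j k * elemPoly_mul_homSeries x i j

/-- Removing more variables than there are leaves a polynomial. -/
theorem elemPoly_mul_homSeries_of_le (x : ℕ → A) {i j k : ℕ} (hij : i ≤ j) (hjk : j ≤ k) :
    (elemPoly x i k : A⟦X⟧) * homSeries x i j = elemPoly x j k := by
  have h : elemPoly x i k = elemPoly x i j * elemPoly x j k :=
    (Finset.prod_Ico_consecutive _ hij hjk).symm
  rw [h]
  push_cast
  linear_combination (elemPoly x j k : A⟦X⟧) * elemPoly_mul_homSeries x i j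

/-- The coefficient of a power series at an integer exponent. -/
noncomputable def intCoeff (F : A⟦X⟧) (u : ℤ) : A := if u < 0 then 0 else coeff u.toNat F

theorem intCoeff_of_neg (F : A⟦X⟧) {u : ℤ} (hu : u < 0) : intCoeff F u = 0 := if_pos hu

theorem intCoeff_natCast (F : A⟦X⟧) (m : ℕ) : intCoeff F m = coeff m F := by
  simp [intCoeff]

theorem intCoeff_one (u : ℤ) : intCoeff (1 : A⟦X⟧) u = if u = 0 then 1 else 0 := by
  rcases lt_or_ge u 0 with hu | hu
  · rw [intCoeff_of_neg _ hu, if_neg hu.ne]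
  · lift u to ℕ using hu
    simp [intCoeff_natCast, coeff_one]

theorem intCoeff_add (F G : A⟦X⟧) (u : ℤ) :
    intCoeff (F + G) u = intCoeff F u + intCoeff G u := by
  unfold intCoeff
  split_ifs <;> simp

theorem intCoeff_sum {ι : Type*} (s : Finset ι) (F : ι → A⟦X⟧) (u : ℤ) :
    intCoeff (∑ k ∈ s, F k) u = ∑ k ∈ s, intCoeff (F k) u := by
  unfold intCoeff
  split_ifs <;> simp

theorem intCoeff_C_mul_X_pow_mul (a : A) (k : ℕ) (F : A⟦X⟧) (u : ℤ) :
    intCoeff (PowerSeries.C a * (X ^ k * F)) u = a * intCoeff F (u - k) := by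
  rcases lt_or_ge u 0 with hu | hu
  · rw [intCoeff_of_neg _ hu, intCoeff_of_neg _ (by omega), mul_zero]
  · lift u to ℕ using hu
    rw [intCoeff_natCast, coeff_C_mul, coeff_X_pow_mul']
    split_ifs with h
    · rw [← Nat.cast_sub h, intCoeff_natCast]
    · rw [intCoeff_of_neg _ (by omega)]

/-- Source of all row and column operations that change the variables: the degree of `P` limits how
many neighbouring rows or columns are combined. -/
theorem intCoeff_polynomial_mul (P : Polynomial A) {d : ℕ} (hd : P.natDegree ≤ d) (F : A⟦X⟧)
    (u : ℤ) : intCoeff ((P : A⟦X⟧) * F) u =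
      ∑ k ∈ Finset.range (d + 1), P.coeff k * intCoeff F (u - k) := by
  have h : (P : A⟦X⟧) * F =
      ∑ k ∈ Finset.range (d + 1), PowerSeries.C (P.coeff k) * (X ^ k * F) := by
    conv_lhs => rw [P.as_sum_range_C_mul_X_pow' (Nat.lt_succ_of_le hd)]
    rw [← Polynomial.coeToPowerSeries.ringHom_apply, map_sum, Finset.sum_mul]
    refine Finset.sum_congr rfl fun k _ => ?_
    rw [Polynomial.coeToPowerSeries.ringHom_apply]
    push_cast
    ring
  rw [h, intCoeff_sum]
  exact Finset.sum_congr rfl fun k _ => intCoeff_C_mul_X_pow_mul _ _ _ _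

theorem intCoeff_polynomial_of_natDegree_lt (P : Polynomial A) {u : ℤ}
    (hu : (P.natDegree : ℤ) < u) : intCoeff (P : A⟦X⟧) u = 0 := by
  have h0 : 0 ≤ u := by omega
  lift u to ℕ using h0
  rw [intCoeff_natCast, Polynomial.coeff_coe]
  exact Polynomial.coeff_eq_zero_of_natDegree_lt (by exact_mod_cast hu)

theorem intCoeff_homSeries_succ (x : ℕ → A) (N : ℕ) (u : ℤ) :
    intCoeff (homSeries x 0 (N + 1)) u =
      intCoeff (homSeries x 0 N) u + x N * intCoeff (homSeries x 0 (N + 1)) (u - 1) := by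
  have h : homSeries x 0 (N + 1) = homSeries x 0 N +
      PowerSeries.C (x N) * (X ^ 1 * homSeries x 0 (N + 1)) := by
    have h1 : homSeries x 0 (N + 1) = homSeries x 0 N * geomSeries (x N) :=
      Finset.prod_Ico_succ_top (Nat.zero_le N) _
    have h2 := geomSeries_eq (x N)
    rw [h1]
    linear_combination homSeries x 0 N * h2
  conv_lhs => rw [h]
  rw [intCoeff_add, intCoeff_C_mul_X_pow_mul]
  simp

/-- Telescoping of `intCoeff_homSeries_succ`. The two terms on the right will be entries of adjacent
rows of `flagMatrix`. -/
theorem sum_Icc_intCoeff_homSeries (x : ℕ → A) (N : ℕ) (c : ℤ) (a b : ℕ) (hab : a ≤ b) :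
    ∑ m ∈ Finset.Icc a b, x N ^ (b - m) * intCoeff (homSeries x 0 N) (m + c) =
      intCoeff (homSeries x 0 (N + 1)) (b + c) -
        x N ^ (b + 1 - a) * intCoeff (homSeries x 0 (N + 1)) (a - 1 + c) := by
  induction b, hab using Nat.le_induction with
  | base =>
    rw [intCoeff_homSeries_succ x N (a + c)]
    simp [show (a : ℤ) + c - 1 = a - 1 + c by ring]
  | succ b hab ih =>
    rw [Finset.sum_Icc_succ_top (by omega), intCoeff_homSeries_succ x N ((b + 1 : ℕ) + c)]
    have h : ∑ m ∈ Finset.Icc a b, x N ^ (b + 1 - m) * intCoeff (homSeries x 0 N) (m + c) =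
        x N * ∑ m ∈ Finset.Icc a b, x N ^ (b - m) * intCoeff (homSeries x 0 N) (m + c) := by
      rw [Finset.mul_sum]
      refine Finset.sum_congr rfl fun m hm => ?_
      rw [Finset.mem_Icc] at hm
      rw [Nat.succ_sub hm.2, pow_succ']
      ring
    rw [h, ih, Nat.succ_sub (show a ≤ b + 1 by omega), pow_succ' (x N),
      show ((b + 1 : ℕ) : ℤ) + c - 1 = b + c by push_cast; ring]
    simp only [Nat.sub_self, pow_zero]
    ring

theorem coeff_prod_geomSeries {ι : Type*} [DecidableEq ι] (s : Finset ι) (f : ι → A) (u : ℕ) :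
    coeff u (∏ l ∈ s, geomSeries (f l)) =
      ∑ m ∈ s.sym u, ((m : Multiset ι).map f).prod := by
  induction s using Finset.induction_on generalizing u with
  | empty =>
    cases u with
    | zero =>
      simp only [Finset.prod_empty, coeff_zero_one, Finset.sym_zero, Finset.sum_singleton]
      exact Multiset.prod_zero.symm
    | succ u => simp [coeff_one]
  | insert a s ha ih =>
    -- Multisets on `insert a s` are sorted by the multiplicity of `a`, which matches the Cauchy
    -- product with the geometric series of `f a`.
    rw [Finset.prod_insert ha, coeff_mul, Finset.Nat.sum_antidiagonal_eq_sum_range_succ_mk,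
      ← Finset.sum_coe_sort ((insert a s).sym u),
      ← (Finset.symInsertEquiv ha).symm.sum_comp, Fintype.sum_sigma,
      Finset.sum_range]
    refine Finset.sum_congr rfl fun i _ => ?_
    rw [ih, geomSeries, coeff_mk, Finset.mul_sum, ← Finset.sum_coe_sort (s.sym (u - i))]
    refine Finset.sum_congr rfl fun m _ => ?_
    have h : (((Finset.symInsertEquiv ha).symm ⟨i, m⟩ : (insert a s).sym u) : Sym ι u) =
      m.1.fill a i := rfl
    rw [h, Sym.coe_fill, Multiset.map_add, Multiset.prod_add, Sym.coe_replicate]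
    simp [mul_comm]

/-- The variables of `MvPolynomial (Fin n) ℤ`, indexed by all natural numbers. -/
noncomputable def natVar (n : ℕ) (l : ℕ) : MvPolynomial (Fin n) ℤ :=
  if h : l < n then MvPolynomial.X ⟨l, h⟩ else 0

theorem natVar_val {n : ℕ} (l : Fin n) : natVar n l = MvPolynomial.X l := by
  simp [natVar]

theorem completeHomogeneous_eq_intCoeff {n : ℕ} (u : ℤ) (i k : Fin n) :
    completeHomogeneous u i k = intCoeff (homSeries (natVar n) i (k + 1)) u := by
  have h : homSeries (natVar n) i (k + 1) =
      ∏ l ∈ Finset.Icc i k, geomSeries (MvPolynomial.X l : MvPolynomial (Fin n) ℤ) := by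
    have h1 : Finset.Ico (i : ℕ) (k + 1) = (Finset.Icc i k).map Fin.valEmbedding := by
      rw [Fin.map_valEmbedding_Icc]
      rfl
    rw [homSeries, h1, Finset.prod_map]
    refine Finset.prod_congr rfl fun l _ => ?_
    rw [Fin.valEmbedding_apply, natVar_val]
  unfold completeHomogeneous intCoeff
  rw [h, coeff_prod_geomSeries]

end Series

end RowBound

namespace RowBound

/-! ### The determinant of a flag -/

section FlagDet

open Matrix

variable {A : Type*} [CommRing A] {n : ℕ}

theorem det_mul_of_unitriangular (U M : Matrix (Fin n) (Fin n) A)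
    (hU : ∀ i j, j < i → U i j = 0) (hdiag : ∀ i, U i i = 1) : (U * M).det = M.det := by
  rw [det_mul, det_of_isUpperTriangular fun i j h => hU i j h]
  simp [hdiag]

/-! ### Horizontal strips and the recursion of the determinant -/

/-- The part after the `j`-th one, or `0`. -/
def nextPart (lam : Fin n → ℕ) (j : Fin n) : ℕ :=
  if h : (j : ℕ) + 1 < n then lam ⟨j + 1, h⟩ else 0

theorem nextPart_le {lam : Fin n → ℕ} (hlam : Antitone lam) (j : Fin n) :
    nextPart lam j ≤ lam j := by
  unfold nextPart
  split_ifs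
  · exact hlam (by rw [Fin.le_def]; simp)
  · exact Nat.zero_le _

theorem le_nextPart {lam : Fin n → ℕ} (hlam : Antitone lam) {i j : Fin n} (hij : i < j) :
    lam j ≤ nextPart lam i := by
  rw [Fin.lt_def] at hij
  rw [nextPart, dif_pos (by omega)]
  exact hlam (by rw [Fin.le_def]; simpa using hij)

/-- The parts `μ j` that a horizontal strip ending in rows with bound `N + 1` may leave of
`lam j`. -/
def stripParts (φ lam : Fin n → ℕ) (N : ℕ) (j : Fin n) : Finset ℕ :=
  if φ j = N + 1 then Finset.Icc (nextPart lam j) (lam j) else {lam j}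

theorem le_of_mem_stripParts {φ lam μ : Fin n → ℕ} {N : ℕ}
    (hμ : μ ∈ Fintype.piFinset (stripParts φ lam N)) (i : Fin n) : μ i ≤ lam i := by
  have h := Fintype.mem_piFinset.1 hμ i
  unfold stripParts at h
  split_ifs at h
  · exact (Finset.mem_Icc.1 h).2
  · exact (Finset.mem_singleton.1 h).le

theorem eq_of_mem_stripParts {φ lam μ : Fin n → ℕ} {N : ℕ}
    (hμ : μ ∈ Fintype.piFinset (stripParts φ lam N)) (i : Fin n) (hi : φ i ≠ N + 1) :
    μ i = lam i := by
  have h := Fintype.mem_piFinset.1 hμ i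
  rw [stripParts, if_neg hi] at h
  exact Finset.mem_singleton.1 h

theorem interlace_of_mem_stripParts {φ lam μ : Fin n → ℕ} {N : ℕ} (hlam : Antitone lam)
    (hμ : μ ∈ Fintype.piFinset (stripParts φ lam N)) {i j : Fin n} (hij : i < j) :
    lam j ≤ μ i := by
  have h := Fintype.mem_piFinset.1 hμ i
  unfold stripParts at h
  split_ifs at h
  · exact (le_nextPart hlam hij).trans (Finset.mem_Icc.1 h).1
  · exact (hlam hij.le).trans (Finset.mem_singleton.1 h).ge

theorem antitone_of_mem_stripParts {φ lam μ : Fin n → ℕ} {N : ℕ} (hlam : Antitone lam)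
    (hμ : μ ∈ Fintype.piFinset (stripParts φ lam N)) : Antitone μ := by
  intro i j hij
  rcases hij.eq_or_lt with rfl | h
  · exact le_rfl
  · exact (le_of_mem_stripParts hμ j).trans (interlace_of_mem_stripParts hlam hμ h)

/-- The matrix whose entry at `(j, i)` is the complete homogeneous symmetric polynomial of degree
`lam j - j + i` in the first `φ j` variables. -/
noncomputable def flagMatrix (x : ℕ → A) (φ lam : Fin n → ℕ) : Matrix (Fin n) (Fin n) A :=
  of fun j i => intCoeff (homSeries x 0 (φ j)) (lam j - j + i)

theorem det_flagMatrix_zero (x : ℕ → A) (lam : Fin n → ℕ) :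
    (flagMatrix x (fun _ => 0) lam).det = if lam = 0 then 1 else 0 := by
  have h : ∀ j i, flagMatrix x (fun _ => 0) lam j i =
      if (lam j : ℤ) - j + i = 0 then 1 else 0 := by
    intro j i
    rw [flagMatrix, of_apply, homSeries, Finset.Ico_self, Finset.prod_empty, intCoeff_one]
  rw [det_of_isLowerTriangular]
  · simp_rw [h]
    split_ifs with h0
    · simp [h0]
    · obtain ⟨j, hj⟩ := Function.ne_iff.1 h0
      refine Finset.prod_eq_zero (Finset.mem_univ j) (if_neg ?_)
      have : lam j ≠ 0 := hj
      omega
  · intro i j hij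
    have hij' : (i : ℕ) < j := hij
    rw [h, if_neg (by omega)]

theorem det_flagMatrix_succ (x : ℕ → A) {φ lam : Fin n → ℕ} {N : ℕ} (hφ : Monotone φ)
    (hN : ∀ i, φ i ≤ N + 1) (hlam : Antitone lam) :
    (flagMatrix x φ lam).det = ∑ μ ∈ Fintype.piFinset (stripParts φ lam N),
      x N ^ (∑ i, (lam i - μ i)) * (flagMatrix x (fun i => min (φ i) N) μ).det := by
  -- From row `j` with `φ j = N + 1` subtract the multiple of row `j + 1` that completes the
  -- telescoping sum over `m` from `nextPart lam j` to `lam j`.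
  let U : Matrix (Fin n) (Fin n) A := of fun j k => if k = j then 1 else
    if (k : ℕ) = j + 1 ∧ φ j = N + 1 then - x N ^ (lam j + 1 - nextPart lam j) else 0
  have hU : U * flagMatrix x φ lam = of fun j => ∑ m ∈ stripParts φ lam N j,
      x N ^ (lam j - m) •
        fun i : Fin n => intCoeff (homSeries x 0 (min (φ j) N)) ((m : ℤ) - j + i) := by
    ext j i
    simp only [mul_apply, of_apply, Finset.sum_apply, Pi.smul_apply, smul_eq_mul, U]
    have hsplit : ∀ k : Fin n, (if k = j then (1 : A) else
        if (k : ℕ) = j + 1 ∧ φ j = N + 1 then - x N ^ (lam j + 1 - nextPart lam j) else 0) *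
          flagMatrix x φ lam k i =
        (if k = j then flagMatrix x φ lam k i else 0) +
        (if (k : ℕ) = j + 1 ∧ φ j = N + 1 then
          - x N ^ (lam j + 1 - nextPart lam j) * flagMatrix x φ lam k i else 0) := by
      intro k
      by_cases h1 : k = j
      · subst h1
        simp
      · simp [h1]
    rw [Finset.sum_congr rfl fun k _ => hsplit k, Finset.sum_add_distrib,
      Finset.sum_ite_eq' Finset.univ j, if_pos (Finset.mem_univ _)]
    by_cases hj : φ j = N + 1
    · have hmin : min (φ j) N = N := by omega
      rw [stripParts, if_pos hj, hmin]
      have hsum := sum_Icc_intCoeff_homSeries x N (-(j : ℤ) + i) (nextPart lam j) (lam j)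
        (nextPart_le hlam j)
      simp only [← add_assoc, ← sub_eq_add_neg] at hsum
      rw [hsum]
      by_cases hjn : (j : ℕ) + 1 < n
      -- Monotonicity of the flag is what lets row `j + 1` use the same `N + 1` variables.
      · have hj' : φ ⟨j + 1, hjn⟩ = N + 1 :=
          le_antisymm (hN _) (hj ▸ hφ (by rw [Fin.le_def]; simp))
        rw [Finset.sum_eq_single (⟨j + 1, hjn⟩ : Fin n)]
        · rw [if_pos ⟨rfl, hj⟩]
          simp only [flagMatrix, of_apply, hj, hj']
          have hnp : nextPart lam j = lam ⟨j + 1, hjn⟩ := dif_pos hjn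
          rw [hnp]
          push_cast
          rw [show (lam ⟨j + 1, hjn⟩ : ℤ) - (j + 1) + i = lam ⟨j + 1, hjn⟩ - 1 - j + i by ring]
          ring
        · intro k _ hk
          rw [if_neg]
          rintro ⟨h, -⟩
          exact hk (Fin.ext h)
        · simp
      · rw [Finset.sum_eq_zero]
        · have hnp : nextPart lam j = 0 := dif_neg hjn
          -- In the last row there is nothing to subtract: the lower end of the telescoping sum has
          -- degree `i - n`.
          have hneg : ((0 : ℕ) : ℤ) - 1 - j + i < 0 := by have := i.2; push_cast; omega
          rw [hnp, intCoeff_of_neg _ hneg]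
          simp [flagMatrix, hj]
        · intro k _
          rw [if_neg]
          rintro ⟨h, -⟩
          omega
    · have hmin : min (φ j) N = φ j := by have := hN j; omega
      rw [stripParts, if_neg hj, hmin]
      simp [hj, flagMatrix]
  rw [← det_mul_of_unitriangular U (flagMatrix x φ lam), hU]
  -- Each row is now a sum over `m`; expanding multilinearly chooses one `m = μ j` per row.
  · have hml := (detRowAlternating : (Fin n → A) [⋀^Fin n]→ₗ[A] A).toMultilinearMap.map_sum_finset
      (fun j (m : ℕ) => x N ^ (lam j - m) •
        fun i : Fin n => intCoeff (homSeries x 0 (min (φ j) N)) ((m : ℤ) - j + i))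
      (stripParts φ lam N)
    refine hml.trans (Finset.sum_congr rfl fun μ _ => ?_)
    rw [MultilinearMap.map_smul_univ, Finset.prod_pow_eq_pow_sum]
    rfl
  · intro i j hij
    rw [Fin.lt_def] at hij
    simp only [U, of_apply]
    rw [if_neg (by intro h; subst h; omega), if_neg (by omega)]
  · intro i
    simp [U]

end FlagDet

end RowBound

namespace RowBound

/-! ### Flagged tableaux -/

section FlagTableaux

variable {A : Type*} [CommRing A] {n : ℕ}

/-- The semistandard fillings `T` of the rows of lengths `lam i` with values less than `φ i` in row
`i`, extended by `0`. -/
def flagTableaux (φ lam : Fin n → ℕ) : Set (Fin n → ℕ → ℕ) :=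
  {T | (∀ i j, lam i ≤ j → T i j = 0) ∧ (∀ i j, j < lam i → T i j < φ i) ∧
    (∀ i j j', j < j' → j' < lam i → T i j ≤ T i j') ∧
    ∀ i i' j, i < i' → j < lam i' → T i j < T i' j}

theorem flagTableaux_finite (φ lam : Fin n → ℕ) : (flagTableaux φ lam).Finite := by
  let f : flagTableaux φ lam → ((i : Fin n) → Fin (lam i) → Fin (φ i)) :=
    fun T i j => ⟨T.1 i j, T.2.2.1 i j j.2⟩
  refine Set.finite_coe_iff.mp (Finite.of_injective f ?_)
  intro S T h
  apply Subtype.ext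
  funext i j
  by_cases hj : j < lam i
  · exact congrArg Fin.val (congrFun (congrFun h i) ⟨j, hj⟩)
  · rw [S.2.1 i j (not_lt.1 hj), T.2.1 i j (not_lt.1 hj)]

/-- The generating function of the semistandard fillings with a given flag. -/
noncomputable def flagSum (x : ℕ → A) (φ lam : Fin n → ℕ) : A :=
  ∑ T ∈ (flagTableaux_finite φ lam).toFinset, ∏ i, ∏ j ∈ Finset.range (lam i), x (T i j)

theorem flagSum_zero (x : ℕ → A) (lam : Fin n → ℕ) :
    flagSum x (fun _ => 0) lam = if lam = 0 then 1 else 0 := by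
  unfold flagSum
  split_ifs with h
  · subst h
    rw [Finset.sum_eq_single 0]
    · simp
    · intro T hT h0
      rw [Set.Finite.mem_toFinset] at hT
      exact absurd (funext fun i => funext fun j => hT.1 i j (Nat.zero_le _)) h0
    · intro h0
      refine absurd ?_ h0
      rw [Set.Finite.mem_toFinset]
      simp [flagTableaux]
  · rw [Finset.sum_eq_zero]
    intro T hT
    rw [Set.Finite.mem_toFinset] at hT
    obtain ⟨j, hj⟩ := Function.ne_iff.1 h
    exact absurd (hT.2.1 j 0 (Nat.pos_of_ne_zero hj)) (Nat.not_lt_zero _)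

/-! ### Removing the largest value from a filling -/

/-- The number of boxes in row `i` with values less than `N`. -/
def partBelow (lam : Fin n → ℕ) (N : ℕ) (T : Fin n → ℕ → ℕ) (i : Fin n) : ℕ :=
  ((Finset.range (lam i)).filter fun j => T i j < N).card

theorem partBelow_le (lam : Fin n → ℕ) (N : ℕ) (T : Fin n → ℕ → ℕ) (i : Fin n) :
    partBelow lam N T i ≤ lam i :=
  (Finset.card_filter_le _ _).trans (Finset.card_range _).le

/-- Rows increase weakly, so the boxes with values below `N` form an initial segment of the row. -/
theorem lt_partBelow_iff {φ lam : Fin n → ℕ} {N : ℕ} {T : Fin n → ℕ → ℕ}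
    (hT : T ∈ flagTableaux φ lam) {i : Fin n} {j : ℕ} (hj : j < lam i) :
    j < partBelow lam N T i ↔ T i j < N := by
  have hmono : ∀ k, k ≤ j → T i k ≤ T i j := by
    intro k hk
    rcases hk.eq_or_lt with rfl | h
    · exact le_rfl
    · exact hT.2.2.1 i k j h hj
  constructor
  · intro h
    by_contra hN
    refine absurd h (not_lt.2 ?_)
    rw [← Finset.card_range j]
    refine Finset.card_le_card fun k hk => ?_
    rw [Finset.mem_filter, Finset.mem_range] at hk
    rw [Finset.mem_range]
    by_contra hkj
    have : T i j ≤ T i k := by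
      rcases (not_lt.1 hkj).eq_or_lt with rfl | h'
      · exact le_rfl
      · exact hT.2.2.1 i j k h' hk.1
    omega
  · intro h
    refine Nat.succ_le_iff.1 ?_
    rw [← Finset.card_range j.succ]
    refine Finset.card_le_card fun k hk => ?_
    rw [Finset.mem_range] at hk
    rw [Finset.mem_filter, Finset.mem_range]
    exact ⟨by omega, (hmono k (by omega)).trans_lt h⟩

theorem partBelow_mem_stripParts {φ lam : Fin n → ℕ} {N : ℕ} (hN : ∀ i, φ i ≤ N + 1)
    (hlam : Antitone lam) {T : Fin n → ℕ → ℕ} (hT : T ∈ flagTableaux φ lam) :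
    partBelow lam N T ∈ Fintype.piFinset (stripParts φ lam N) := by
  rw [Fintype.mem_piFinset]
  intro i
  unfold stripParts
  split_ifs with hi
  · rw [Finset.mem_Icc]
    refine ⟨?_, partBelow_le _ _ _ _⟩
    unfold nextPart
    split_ifs with hin
    · by_contra hlt
      rw [not_le] at hlt
      have h1 : i < ⟨i + 1, hin⟩ := by rw [Fin.lt_def]; simp
      -- A box lying above another box has a value less than one that is at most `N`, so it is
      -- counted by `partBelow`.
      have h2 := hT.2.2.2 i ⟨i + 1, hin⟩ _ h1 hlt
      have h3 := hT.2.1 ⟨i + 1, hin⟩ _ hlt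
      have h4 := hN ⟨i + 1, hin⟩
      have h5 := (lt_partBelow_iff (N := N) hT (hlt.trans_le (hlam h1.le))).2 (by omega)
      omega
    · exact Nat.zero_le _
  · rw [Finset.mem_singleton]
    refine le_antisymm (partBelow_le _ _ _ _) ?_
    by_contra hlt
    rw [not_le] at hlt
    have h1 := hT.2.1 i _ hlt
    have h2 := hN i
    have := (lt_partBelow_iff (N := N) hT hlt).2 (by omega)
    omega

/-- The filling with the boxes of values `N` removed, for `μ = partBelow lam N T`. -/
def restrictRows (μ : Fin n → ℕ) (T : Fin n → ℕ → ℕ) (i : Fin n) (j : ℕ) : ℕ :=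
  if j < μ i then T i j else 0

/-- The filling extended by boxes of value `N`. -/
def extendRows (lam μ : Fin n → ℕ) (N : ℕ) (U : Fin n → ℕ → ℕ) (i : Fin n) (j : ℕ) : ℕ :=
  if j < μ i then U i j else if j < lam i then N else 0

theorem restrictRows_mem {φ lam : Fin n → ℕ} {N : ℕ}
    {T : Fin n → ℕ → ℕ} (hT : T ∈ flagTableaux φ lam) (hlam : Antitone lam)
    (hμ : partBelow lam N T ∈ Fintype.piFinset (stripParts φ lam N)) :
    restrictRows (partBelow lam N T) T ∈
      flagTableaux (fun i => min (φ i) N) (partBelow lam N T) := by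
  have hle := partBelow_le lam N T
  have hanti := antitone_of_mem_stripParts hlam hμ
  refine ⟨fun i j hj => if_neg (not_lt.2 hj), fun i j hj => ?_, fun i j j' hjj' hj' => ?_,
    fun i i' j hii' hj => ?_⟩
  · rw [restrictRows, if_pos hj]
    have hj' := hj.trans_le (hle i)
    exact lt_min (hT.2.1 i j hj') ((lt_partBelow_iff hT hj').1 hj)
  · rw [restrictRows, restrictRows, if_pos hj', if_pos (hjj'.trans hj')]
    exact hT.2.2.1 i j j' hjj' (hj'.trans_le (hle i))
  · rw [restrictRows, restrictRows, if_pos hj, if_pos (hj.trans_le (hanti hii'.le))]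
    exact hT.2.2.2 i i' j hii' (hj.trans_le (hle i'))

theorem extendRows_mem {φ lam μ : Fin n → ℕ} {N : ℕ} (hlam : Antitone lam)
    (hμ : μ ∈ Fintype.piFinset (stripParts φ lam N)) {U : Fin n → ℕ → ℕ}
    (hU : U ∈ flagTableaux (fun i => min (φ i) N) μ) :
    extendRows lam μ N U ∈ flagTableaux φ lam := by
  have hle := le_of_mem_stripParts hμ
  have hb : ∀ i j, j < μ i → U i j < φ i ∧ U i j < N := fun i j hj => lt_min_iff.1 (hU.2.1 i j hj)
  refine ⟨fun i j hj => ?_, fun i j hj => ?_, fun i j j' hjj' hj' => ?_, fun i i' j hii' hj => ?_⟩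
  · rw [extendRows, if_neg (not_lt.2 ((hle i).trans hj)), if_neg (not_lt.2 hj)]
  · unfold extendRows
    split_ifs with h
    · exact (hb i j h).1
    · have : φ i = N + 1 := by
        by_contra hi
        exact h (eq_of_mem_stripParts hμ i hi ▸ hj)
      omega
  · unfold extendRows
    rw [if_pos hj', if_pos (hjj'.trans hj')]
    split_ifs with h1 h2 h2
    · exact hU.2.2.1 i j j' hjj' h2
    · exact (hb i j h1).2.le
    · omega
    · exact le_rfl
  -- Interlacing: the box above any box of `lam` belongs to `μ`, so no two added boxes share a
  -- column.
  · have hji := hj.trans_le (interlace_of_mem_stripParts hlam hμ hii')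
    unfold extendRows
    rw [if_pos hji, if_pos hj]
    split_ifs with h1
    · exact hU.2.2.2 i i' j hii' h1
    · exact (hb i j hji).2

theorem partBelow_extendRows {φ lam μ : Fin n → ℕ} {N : ℕ}
    (hμ : μ ∈ Fintype.piFinset (stripParts φ lam N)) {U : Fin n → ℕ → ℕ}
    (hU : U ∈ flagTableaux (fun i => min (φ i) N) μ) :
    partBelow lam N (extendRows lam μ N U) = μ := by
  funext i
  have hle := le_of_mem_stripParts hμ i
  suffices h : ((Finset.range (lam i)).filter fun j => extendRows lam μ N U i j < N) =
      Finset.range (μ i) by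
    rw [partBelow, h, Finset.card_range]
  ext j
  rw [Finset.mem_filter, Finset.mem_range, Finset.mem_range, extendRows]
  constructor
  · rintro ⟨h1, h2⟩
    by_contra h
    simp [h, h1] at h2
  · intro h
    refine ⟨h.trans_le hle, ?_⟩
    rw [if_pos h]
    exact (lt_min_iff.1 (hU.2.1 i j h)).2

theorem restrictRows_extendRows {φ lam μ : Fin n → ℕ} {N : ℕ} {U : Fin n → ℕ → ℕ}
    (hU : U ∈ flagTableaux φ μ) : restrictRows μ (extendRows lam μ N U) = U := by
  funext i j
  unfold restrictRows extendRows
  split_ifs with h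
  · rfl
  · exact (hU.1 i j (not_lt.1 h)).symm

theorem extendRows_restrictRows {φ lam : Fin n → ℕ} {N : ℕ} (hN : ∀ i, φ i ≤ N + 1)
    {T : Fin n → ℕ → ℕ} (hT : T ∈ flagTableaux φ lam) :
    extendRows lam (partBelow lam N T) N (restrictRows (partBelow lam N T) T) = T := by
  funext i j
  unfold extendRows restrictRows
  split_ifs with h1 h2
  · rfl
  · rw [lt_partBelow_iff hT h2] at h1
    have := hT.2.1 i j h2
    have := hN i
    omega
  · exact (hT.1 i j (not_lt.1 h2)).symm

theorem prod_extendRows (x : ℕ → A) {lam μ : Fin n → ℕ} (N : ℕ) (hle : ∀ i, μ i ≤ lam i)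
    (U : Fin n → ℕ → ℕ) :
    ∏ i, ∏ j ∈ Finset.range (lam i), x (extendRows lam μ N U i j) =
      x N ^ (∑ i, (lam i - μ i)) * ∏ i, ∏ j ∈ Finset.range (μ i), x (U i j) := by
  rw [← Finset.prod_pow_eq_pow_sum, ← Finset.prod_mul_distrib]
  refine Finset.prod_congr rfl fun i _ => ?_
  rw [← Finset.prod_range_mul_prod_Ico _ (hle i), mul_comm]
  congr 1
  · rw [Finset.prod_congr rfl (g := fun _ => x N)]
    · simp
    · intro j hj
      rw [Finset.mem_Ico] at hj
      rw [extendRows, if_neg (not_lt.2 hj.1), if_pos hj.2]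
  · refine Finset.prod_congr rfl fun j hj => ?_
    rw [extendRows, if_pos (Finset.mem_range.1 hj)]

theorem flagSum_succ (x : ℕ → A) {φ lam : Fin n → ℕ} {N : ℕ}
    (hN : ∀ i, φ i ≤ N + 1) (hlam : Antitone lam) :
    flagSum x φ lam = ∑ μ ∈ Fintype.piFinset (stripParts φ lam N),
      x N ^ (∑ i, (lam i - μ i)) * flagSum x (fun i => min (φ i) N) μ := by
  unfold flagSum
  rw [← Finset.sum_fiberwise_of_maps_to (g := partBelow lam N)
    (t := Fintype.piFinset (stripParts φ lam N))]
  · refine Finset.sum_congr rfl fun μ hμ => ?_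
    rw [Finset.mul_sum]
    refine Finset.sum_nbij' (restrictRows μ) (extendRows lam μ N) ?_ ?_ ?_ ?_ ?_
    · intro T hT
      rw [Finset.mem_filter, Set.Finite.mem_toFinset] at hT
      obtain ⟨hT, rfl⟩ := hT
      rw [Set.Finite.mem_toFinset]
      exact restrictRows_mem hT hlam hμ
    · intro U hU
      rw [Set.Finite.mem_toFinset] at hU
      rw [Finset.mem_filter, Set.Finite.mem_toFinset]
      exact ⟨extendRows_mem hlam hμ hU, partBelow_extendRows hμ hU⟩
    · intro T hT
      rw [Finset.mem_filter, Set.Finite.mem_toFinset] at hT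
      obtain ⟨hT, rfl⟩ := hT
      exact extendRows_restrictRows hN hT
    · intro U hU
      rw [Set.Finite.mem_toFinset] at hU
      exact restrictRows_extendRows hU
    · intro T hT
      rw [Finset.mem_filter, Set.Finite.mem_toFinset] at hT
      obtain ⟨hT, rfl⟩ := hT
      rw [← prod_extendRows x N (partBelow_le lam N T), extendRows_restrictRows hN hT]
  · intro T hT
    rw [Set.Finite.mem_toFinset] at hT
    exact partBelow_mem_stripParts hN hlam hT

/-- The generating function of the semistandard fillings with a weakly increasing flag is a
determinant in complete homogeneous symmetric polynomials. -/
theorem flagSum_eq_det (x : ℕ → A) {φ lam : Fin n → ℕ} (hφ : Monotone φ) (hlam : Antitone lam)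
    (N : ℕ) (hN : ∀ i, φ i ≤ N) : flagSum x φ lam = (flagMatrix x φ lam).det := by
  induction N generalizing φ lam with
  | zero =>
    obtain rfl : φ = fun _ => 0 := funext fun i => Nat.le_zero.1 (hN i)
    rw [flagSum_zero, det_flagMatrix_zero]
  | succ N ih =>
    rw [flagSum_succ x hN hlam, det_flagMatrix_succ x hφ hN hlam]
    refine Finset.sum_congr rfl fun μ hμ => ?_
    rw [ih (fun i j hij => min_le_min_right N (hφ hij)) (antitone_of_mem_stripParts hlam hμ)
      fun i => min_le_right _ _]

end FlagTableaux

end RowBound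

namespace RowBound

/-! ### Changing the flag and the first variables of the determinant -/

section UnitriangularOperations

open Matrix

variable {A : Type*} [CommRing A] {n : ℕ}

/-- Passing from `φ j` to `δ j` variables multiplies the series by a polynomial of degree at most `ν
j - j`. Lowering the degree by `k` in row `j` gives row `j + k`, since `φ` and `lam` agree there. -/
theorem det_flagMatrix_eq_of_staircase (x : ℕ → A) {φ δ lam : Fin n → ℕ} (ν : Fin n → Fin n)
    (hν : ∀ i, i ≤ ν i) (hconst : ∀ i j, i ≤ j → j ≤ ν i → φ j = φ i ∧ lam j = lam i)
    (hle : ∀ i, δ i ≤ φ i) (hδ : ∀ i, φ i - δ i ≤ ν i - i) :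
    (flagMatrix x δ lam).det = (flagMatrix x φ lam).det := by
  let U : Matrix (Fin n) (Fin n) A := of fun j l =>
    if j ≤ l then (elemPoly x (δ j) (φ j)).coeff (l - j) else 0
  rw [← det_mul_of_unitriangular U (flagMatrix x φ lam)
    (fun i j hij => if_neg (not_le.2 hij))
    (fun i => by simp [U, elemPoly_coeff_zero])]
  congr 1
  ext j i
  have hdeg := (elemPoly_natDegree_le x (δ j) (φ j)).trans (hδ j)
  rw [flagMatrix, of_apply, ← elemPoly_mul_homSeries_right x (Nat.zero_le _) (hle j),
    intCoeff_polynomial_mul _ hdeg, mul_apply,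
    ← Finset.sum_subset (Finset.subset_univ (Finset.Icc j (ν j)))]
  · symm
    refine Finset.sum_nbij (fun l => (l : ℕ) - j) ?_ ?_ ?_ ?_
    · intro l hl
      rw [Finset.mem_Icc, Fin.le_def, Fin.le_def] at hl
      rw [Finset.mem_range]
      omega
    · intro l hl l' hl' h
      rw [Finset.mem_coe, Finset.mem_Icc, Fin.le_def, Fin.le_def] at hl hl'
      apply Fin.ext
      dsimp only at h
      omega
    · intro k hk
      rw [Finset.mem_coe, Finset.mem_range] at hk
      have hνj := Fin.le_def.1 (hν j)
      refine ⟨⟨j + k, by omega⟩, ?_, by simp⟩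
      rw [Finset.mem_coe, Finset.mem_Icc, Fin.le_def, Fin.le_def]
      dsimp only
      omega
    · intro l hl
      rw [Finset.mem_Icc] at hl
      obtain ⟨h1, h2⟩ := hconst j l hl.1 hl.2
      have h3 := Fin.le_def.1 hl.1
      simp only [U, flagMatrix, of_apply]
      rw [if_pos hl.1, h1, h2]
      congr 2
      omega
  · intro l _ hl
    rw [Finset.mem_Icc, not_and] at hl
    simp only [U, of_apply]
    split_ifs with h
    · have h2 := Fin.lt_def.1 (not_le.1 (hl h))
      have h3 := Fin.le_def.1 (hν j)
      rw [Polynomial.coeff_eq_zero_of_natDegree_lt (by omega), zero_mul]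
    · rw [zero_mul]

theorem det_homSeries_eq_det_flagMatrix (x : ℕ → A) {δ lam : Fin n → ℕ}
    (hδ : ∀ j : Fin n, (j : ℕ) < δ j) :
    (of fun j i : Fin n => intCoeff (homSeries x i (δ j)) (lam j - j + i)).det =
      (flagMatrix x δ lam).det := by
  let V : Matrix (Fin n) (Fin n) A := of fun l i =>
    if l ≤ i then (elemPoly x 0 i).coeff (i - l) else 0
  have hV : V.det = 1 := by
    have h := det_mul_of_unitriangular V 1 (fun i j hij => if_neg (not_le.2 hij))
      (fun i => by simp [V, elemPoly_coeff_zero])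
    rwa [mul_one, det_one] at h
  rw [← mul_one (flagMatrix x δ lam).det, ← hV, ← det_mul]
  congr 1
  ext j i
  have hj := hδ j
  have hkey : intCoeff (homSeries x i (δ j)) ((lam j : ℤ) - j + i) =
      intCoeff ((elemPoly x 0 i : PowerSeries A) * homSeries x 0 (δ j)) ((lam j : ℤ) - j + i) := by
    rcases le_total (i : ℕ) (δ j) with h | h
    · rw [elemPoly_mul_homSeries_left x (Nat.zero_le _) h]
    -- No variables remain on the left, and the product on the right is a polynomial of degree at
    -- most `i - δ j`. By `j < δ j` the exponent is larger than this and positive, so both sides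
    -- vanish.
    · have hdeg := elemPoly_natDegree_le x (δ j) i
      rw [elemPoly_mul_homSeries_of_le x (Nat.zero_le _) h,
        intCoeff_polynomial_of_natDegree_lt _ (by omega), homSeries, Finset.Ico_eq_empty_of_le h,
        Finset.prod_empty, intCoeff_one, if_neg (by omega)]
  have hdeg := elemPoly_natDegree_le x 0 i
  rw [Nat.sub_zero] at hdeg
  rw [of_apply, hkey, intCoeff_polynomial_mul _ hdeg, mul_apply,
    ← Finset.sum_subset (Finset.subset_univ (Finset.Iic i))]
  · symm
    refine Finset.sum_nbij (fun l => (i : ℕ) - l) ?_ ?_ ?_ ?_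
    · intro l hl
      rw [Finset.mem_range]
      omega
    · intro l hl l' hl' h
      rw [Finset.mem_coe, Finset.mem_Iic, Fin.le_def] at hl hl'
      apply Fin.ext
      dsimp only at h
      omega
    · intro k hk
      rw [Finset.mem_coe, Finset.mem_range] at hk
      refine ⟨⟨i - k, by omega⟩, ?_, ?_⟩
      · rw [Finset.mem_coe, Finset.mem_Iic, Fin.le_def]
        exact Nat.sub_le _ _
      · dsimp only
        omega
    · intro l hl
      rw [Finset.mem_Iic] at hl
      have h3 := Fin.le_def.1 hl
      simp only [V, flagMatrix, of_apply]
      rw [if_pos hl, mul_comm]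
      congr 2
      omega
  · intro l _ hl
    rw [Finset.mem_Iic] at hl
    simp [V, hl]

end UnitriangularOperations

/-! ### Critical indices -/

section Critical

variable {n : ℕ} (R : Finset ℕ) (β : Fin n → Fin n)

theorem mem_criticalFrom {i x : Fin n} :
    x ∈ criticalFrom R β i ↔ i ≤ x ∧ IsCritical R β x := by
  simp [criticalFrom]

theorem le_nextCritical (i : Fin n) : i ≤ nextCritical R β i :=
  ((mem_criticalFrom R β).1 (Finset.min'_mem _ (criticalFrom_nonempty R β i))).1

theorem isCritical_nextCritical (i : Fin n) : IsCritical R β (nextCritical R β i) :=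
  ((mem_criticalFrom R β).1 (Finset.min'_mem _ (criticalFrom_nonempty R β i))).2

variable {R β}

theorem nextCritical_le {i x : Fin n} (hix : i ≤ x) (hx : IsCritical R β x) :
    nextCritical R β i ≤ x :=
  Finset.min'_le _ _ ((mem_criticalFrom R β).2 ⟨hix, hx⟩)

theorem nextCritical_eq_of_le {i j : Fin n} (hij : i ≤ j) (hj : j ≤ nextCritical R β i) :
    nextCritical R β j = nextCritical R β i :=
  le_antisymm (nextCritical_le hj (isCritical_nextCritical R β i))
    (nextCritical_le (hij.trans (le_nextCritical R β j)) (isCritical_nextCritical R β j))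

theorem SameCarrel.mono {i i' j j' : Fin n} (h : SameCarrel R i j) (hi : i ≤ i') (hj : j' ≤ j) :
    SameCarrel R i' j' := fun q hq hlt =>
  h q hq ⟨lt_of_le_of_lt hi hlt.1, hlt.2.trans hj⟩

/-- A divider in between would make the index just before it critical. -/
theorem sameCarrel_nextCritical (i : Fin n) : SameCarrel R i (nextCritical R β i) := by
  rintro q hq ⟨h1, h2⟩
  have hlt := (nextCritical R β i).2
  have h := nextCritical_le (R := R) (β := β) (i := i) (x := ⟨q - 1, by omega⟩)
    (by rw [Fin.le_def]; exact Nat.le_sub_one_of_lt h1)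
    (IsCritical.rightmost _ (Or.inl (by
      change q - 1 + 1 ∈ R
      rwa [Nat.sub_add_cancel (by omega)])))
  rw [Fin.le_def] at h
  dsimp only at h
  omega

/-- This is `δ i ≤ β i`. If it failed, `i` would satisfy `Drops` from `x`, and the maximal such
index would be a critical one in `[i, x)`. -/
theorem entry_nextCritical_le (i : Fin n) :
    (β (nextCritical R β i) : ℕ) ≤ β i + (nextCritical R β i - i) := by
  classical
  set x := nextCritical R β i with hx
  have hix : i ≤ x := le_nextCritical R β i
  rcases hix.eq_or_lt with h | h
  · rw [← h]
    omega
  by_contra hlt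
  have hd : Drops R β x i := by
    refine ⟨h, sameCarrel_nextCritical i, ?_⟩
    rw [Fin.lt_def] at h
    omega
  let s := Finset.univ.filter fun z => Drops R β x z
  have hs : s.Nonempty := ⟨i, by simpa [s] using hd⟩
  have hmem : Drops R β x (s.max' hs) := (Finset.mem_filter.1 (s.max'_mem hs)).2
  have hcrit : IsCritical R β (s.max' hs) :=
    IsCritical.next x _ (isCritical_nextCritical R β i) hmem
      fun z hz => s.le_max' z (by simpa [s] using hz)
  have hmin : x ≤ s.max' hs := nextCritical_le (s.le_max' i (by simpa [s] using hd)) hcrit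
  exact absurd hmem.1 (not_lt.2 hmin)

/-- For a gapless core tuple, replacing each entry by the next critical one gives a weakly
increasing tuple. -/
theorem monotone_entry_nextCritical (hβ : HasFlagCriticalList R β) :
    Monotone fun i => β (nextCritical R β i) := by
  have hstep : ∀ i j : Fin n, (i : ℕ) + 1 = j →
      β (nextCritical R β i) ≤ β (nextCritical R β j) := by
    intro i j hij
    have hij' : i < j := by rw [Fin.lt_def]; omega
    rcases (le_nextCritical R β i).eq_or_lt with h | h
    · rw [← h]
      have hc : IsCritical R β i := by
        have := isCritical_nextCritical R β i
        rwa [← h] at this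
      cases hc with
      | rightmost _ hx =>
        rcases hx with hx | hx
        · exact hβ i j hij (hij ▸ hx)
        · have := j.2
          omega
      -- Here `i` is the maximal drop from `y`, so `z` lies in `(i, y]` and is not a drop itself;
      -- thus `β z ≥ β y - (y - z) > β i + (z - i)`.
      | next y _ hy hd hmax =>
        set z := nextCritical R β j with hz
        have hjz : j ≤ z := le_nextCritical R β j
        have hjy : j ≤ y := by
          have := hd.1
          rw [Fin.lt_def] at this
          rw [Fin.le_def]
          omega
        have hzy : z ≤ y := nextCritical_le hjy hy
        have hgap := hd.2.2
        have hiz : i < z := hij'.trans_le hjz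
        rcases hzy.eq_or_lt with h' | h'
        · rw [h', Fin.le_def]
          have := Fin.lt_def.1 hd.1
          omega
        · have hnd : ¬ Drops R β y z := fun hdz => absurd (hmax z hdz) (not_le.2 hiz)
          have hle : ¬ ((y : ℕ) : ℤ) - ((z : ℕ) : ℤ) < ((β y : ℕ) : ℤ) - ((β z : ℕ) : ℤ) :=
            fun hlt => hnd ⟨h', hd.2.1.mono hiz.le le_rfl, hlt⟩
          rw [Fin.lt_def] at hiz
          rw [Fin.le_def]
          omega
    · rw [nextCritical_eq_of_le hij'.le]
      rw [Fin.lt_def] at h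
      rw [Fin.le_def]
      omega
  have hind : ∀ (d : ℕ) (i j : Fin n), (i : ℕ) + d = j →
      β (nextCritical R β i) ≤ β (nextCritical R β j) := by
    intro d
    induction d with
    | zero =>
      intro i j hij
      rw [show i = j from Fin.ext hij]
    | succ d ih =>
      intro i j hij
      have hj := j.2
      exact (ih i ⟨i + d, by omega⟩ rfl).trans (hstep ⟨i + d, by omega⟩ j (by simpa using by omega))
  intro i j hij
  exact hind (j - i) i j (by rw [Fin.le_def] at hij; omega)

end Critical

/-! ### Row bound sums -/

section RowBoundSums

variable {n : ℕ} {lam : Fin n → ℕ} {hlam : Antitone lam}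

/-- If `lam j < lam i`, then the column with index `lam j` reaches row `i` but not row `j`, and its
length is a divider between them. -/
theorem eq_of_sameCarrel {i j : Fin n} (hij : i ≤ j)
    (h : SameCarrel (columnLengths lam hlam) i j) : lam j = lam i := by
  refine le_antisymm (hlam hij) ?_
  by_contra hlt
  rw [not_le] at hlt
  have hi : ((i : ℕ), lam j) ∈ shape lam hlam := (mem_shape _ _ _ _).2 ⟨i.2, hlt⟩
  have hj : ((j : ℕ), lam j) ∉ shape lam hlam := by
    rw [mem_shape]
    rintro ⟨_, h'⟩
    exact lt_irrefl _ h'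
  have h0 : (0, lam j) ∈ shape lam hlam :=
    (shape lam hlam).up_left_mem (Nat.zero_le _) le_rfl hi
  rw [YoungDiagram.mem_iff_lt_colLen] at hi hj
  rw [YoungDiagram.mem_iff_lt_rowLen] at h0
  refine h ((shape lam hlam).colLen (lam j)) ?_ ⟨hi, not_lt.1 hj⟩
  refine Finset.mem_filter.2 ⟨Finset.mem_image_of_mem _ (Finset.mem_range.2 h0), ?_⟩
  exact (not_lt.1 hj).trans_lt j.2

theorem entry_add_le_of_col {μ : YoungDiagram} (T : SemistandardYoungTableau μ) (i j d : ℕ)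
    (h : (i + d, j) ∈ μ) : T i j + d ≤ T (i + d) j := by
  induction d with
  | zero => exact le_rfl
  | succ d ih =>
    have h1 := ih (μ.up_left_mem (by omega) le_rfl h)
    have h2 := T.col_strict (show i + d < i + (d + 1) by omega) h
    omega

theorem rowBoundSet_nextCritical (β : Fin n → Fin n) :
    rowBoundSet lam hlam (fun i => β (nextCritical (columnLengths lam hlam) β i)) =
      rowBoundSet lam hlam β := by
  have hcol : ∀ (T : SemistandardYoungTableau (shape lam hlam)) (i : Fin n) (j : ℕ),
      ((i : ℕ), j) ∈ shape lam hlam →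
      ((nextCritical (columnLengths lam hlam) β i : ℕ), j) ∈ shape lam hlam ∧
        T i j + (nextCritical (columnLengths lam hlam) β i - i) ≤
          T (nextCritical (columnLengths lam hlam) β i) j := by
    intro T i j hij
    have hle := le_nextCritical (columnLengths lam hlam) β i
    have hmem : ((nextCritical (columnLengths lam hlam) β i : ℕ), j) ∈ shape lam hlam := by
      rw [mem_shape] at hij ⊢
      obtain ⟨_, hj⟩ := hij
      exact ⟨Fin.isLt _, by
        simpa only [Fin.eta, eq_of_sameCarrel hle (sameCarrel_nextCritical i)] using hj⟩
    refine ⟨hmem, ?_⟩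
    have hadd := Nat.add_sub_cancel' (Fin.le_def.1 hle)
    have h := entry_add_le_of_col T i j (nextCritical (columnLengths lam hlam) β i - i)
      (by rwa [hadd])
    rwa [hadd] at h
  ext T
  refine and_congr_right fun _ => ⟨fun h i j hij => ?_, fun h i j hij => ?_⟩
  · obtain ⟨hmem, hle⟩ := hcol T i j hij
    have h1 := h _ j hmem
    beta_reduce at h1
    -- A critical index is its own next critical index, so the bound in that row is the entry of `β`
    -- itself.
    rw [nextCritical_eq_of_le (le_nextCritical _ β i) le_rfl] at h1
    have h2 := entry_nextCritical_le (R := columnLengths lam hlam) (β := β) i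
    omega
  · obtain ⟨hmem, hle⟩ := hcol T i j hij
    exact (Nat.le_add_right _ _).trans (hle.trans (h _ j hmem))

theorem prod_cells_shape {M : Type*} [CommMonoid M] (f : ℕ → ℕ → M) :
    ∏ c ∈ (shape lam hlam).cells, f c.1 c.2 = ∏ i : Fin n, ∏ j ∈ Finset.range (lam i), f i j := by
  rw [Finset.prod_sigma']
  symm
  refine Finset.prod_nbij (fun c => ((c.1 : ℕ), c.2)) ?_ ?_ ?_ ?_
  · rintro ⟨i, j⟩ h
    rw [Finset.mem_sigma, Finset.mem_range] at h
    rw [YoungDiagram.mem_cells, mem_shape]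
    exact ⟨i.2, h.2⟩
  · rintro ⟨i, j⟩ _ ⟨i', j'⟩ _ h
    simp only [Prod.mk.injEq] at h
    obtain ⟨h1, rfl⟩ := h
    rw [Fin.ext h1]
  · rintro ⟨i, j⟩ h
    rw [Finset.mem_coe, YoungDiagram.mem_cells, mem_shape] at h
    obtain ⟨hi, hj⟩ := h
    exact ⟨⟨⟨i, hi⟩, j⟩, by simpa using hj, rfl⟩
  · intro c _
    rfl

theorem tableauMonomial_eq_prod {T : SemistandardYoungTableau (shape lam hlam)}
    (hT : ∀ i j : ℕ, (i, j) ∈ shape lam hlam → T i j < n) :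
    tableauMonomial n T = ∏ i : Fin n, ∏ j ∈ Finset.range (lam i), natVar n (T i j) := by
  rw [← prod_cells_shape (hlam := hlam) fun i j => natVar n (T i j)]
  unfold tableauMonomial
  simp_rw [← Finset.prod_const, Finset.prod_filter]
  rw [Finset.prod_comm]
  refine Finset.prod_congr rfl fun c hc => ?_
  have hlt := hT c.1 c.2 ((YoungDiagram.mem_cells _).1 hc)
  rw [Finset.prod_eq_single (⟨T c.1 c.2, hlt⟩ : Fin n)]
  · simp [natVar, hlt]
  · intro k _ hk
    exact if_neg fun h => hk (Fin.ext h.symm)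
  · simp

theorem rowBoundSum_eq_flagSum (ψ : Fin n → Fin n) :
    rowBoundSum lam hlam ψ = flagSum (natVar n) (fun i => (ψ i : ℕ) + 1) lam := by
  refine Finset.sum_nbij (fun T i j => T i j) ?_ ?_ ?_ ?_
  · intro T hT
    rw [Set.Finite.mem_toFinset] at hT ⊢
    refine ⟨fun i j hj => T.zeros ?_, fun i j hj => ?_, fun i j j' hjj' hj' => ?_,
      fun i i' j hii' hj => ?_⟩
    · rw [mem_shape]
      rintro ⟨_, h⟩
      exact absurd h (not_lt.2 hj)
    · exact Nat.lt_succ_of_le (hT.2 i j ((mem_shape _ _ _ _).2 ⟨i.2, hj⟩))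
    · exact T.row_weak hjj' ((mem_shape _ _ _ _).2 ⟨i.2, hj'⟩)
    · exact T.col_strict hii' ((mem_shape _ _ _ _).2 ⟨i'.2, hj⟩)
  · intro S _ T _ h
    apply SemistandardYoungTableau.ext
    intro i j
    by_cases hij : (i, j) ∈ shape lam hlam
    · obtain ⟨hi, _⟩ := (mem_shape _ _ _ _).1 hij
      exact congrFun (congrFun h ⟨i, hi⟩) j
    · rw [S.zeros hij, T.zeros hij]
  · intro T hT
    rw [Finset.mem_coe, Set.Finite.mem_toFinset] at hT
    obtain ⟨hzero, hbound, hrow, hcol⟩ := hT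
    let S : SemistandardYoungTableau (shape lam hlam) :=
      { entry := fun i j => if h : i < n then T ⟨i, h⟩ j else 0
        row_weak' := by
          intro i j j' hjj' hmem
          obtain ⟨hi, hj⟩ := (mem_shape _ _ _ _).1 hmem
          simp only [hi, dite_true]
          exact hrow _ _ _ hjj' hj
        col_strict' := by
          intro i i' j hii' hmem
          obtain ⟨hi, hj⟩ := (mem_shape _ _ _ _).1 hmem
          have hi' := hii'.trans hi
          simp only [hi, hi', dite_true]
          exact hcol _ _ _ hii' hj
        zeros' := by
          intro i j hmem
          split_ifs with hi
          · refine hzero _ _ (not_lt.1 fun hj => hmem ((mem_shape _ _ _ _).2 ⟨hi, hj⟩))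
          · rfl }
    have hS : ∀ (i : Fin n) (j : ℕ), S i j = T i j := fun i j => dif_pos i.2
    have hle : ∀ (i : Fin n) (j : ℕ), ((i : ℕ), j) ∈ shape lam hlam → S i j ≤ (ψ i : ℕ) := by
      intro i j hmem
      obtain ⟨_, hj⟩ := (mem_shape _ _ _ _).1 hmem
      rw [hS]
      exact Nat.le_of_lt_succ (hbound i j hj)
    refine ⟨S, ?_, funext fun i => funext fun j => hS i j⟩
    rw [Finset.mem_coe, Set.Finite.mem_toFinset]
    refine ⟨fun i j hmem => ?_, hle⟩
    obtain ⟨hi, _⟩ := (mem_shape _ _ _ _).1 hmem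
    exact (hle ⟨i, hi⟩ j hmem).trans_lt (ψ ⟨i, hi⟩).2
  · intro T hT
    rw [Set.Finite.mem_toFinset] at hT
    exact tableauMonomial_eq_prod hT.1

end RowBoundSums

end RowBound

/-! ### Assembly of the identity -/

theorem corollary5p3 (n : ℕ) (lam : Fin n → ℕ) (hlam : Antitone lam) (β : Fin n → Fin n)
    (hβ : RowBound.IsGaplessCore (RowBound.columnLengths lam hlam) β) :
    RowBound.rowBoundSum lam hlam β =
      Matrix.det (Matrix.of fun i j : Fin n =>
        RowBound.completeHomogeneous (((lam j : ℕ) : ℤ) - ((j : ℕ) : ℤ) + ((i : ℕ) : ℤ)) i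
          (RowBound.core (RowBound.columnLengths lam hlam) β j)) := by
  open RowBound in
  set R := columnLengths lam hlam
  have hmono := monotone_entry_nextCritical hβ.2
  -- Upperness at critical indices keeps the subtraction in `core` from truncating and gives `j ≤ δ
  -- j`, as needed for dropping the first variables.
  have hupper : ∀ i, (nextCritical R β i : ℕ) ≤ β (nextCritical R β i) :=
    fun i => Fin.le_def.1 (hβ.1 _)
  have hnext : ∀ i : Fin n, (i : ℕ) ≤ nextCritical R β i := fun i => Fin.le_def.1 (le_nextCritical R β i)
  have hcore : ∀ i : Fin n, (core R β i : ℕ) =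
    β (nextCritical R β i) - (nextCritical R β i - i) := fun i => rfl
  have hsum : rowBoundSum lam hlam β =
      rowBoundSum lam hlam fun i => β (nextCritical R β i) :=
    Finset.sum_congr (by
      ext T
      rw [Set.Finite.mem_toFinset, Set.Finite.mem_toFinset, rowBoundSet_nextCritical β])
      fun _ _ => rfl
  rw [hsum, rowBoundSum_eq_flagSum,
    flagSum_eq_det _ (fun i j hij => Nat.succ_le_succ (Fin.le_def.1 (hmono hij))) hlam n
      (fun i => (β (nextCritical R β i)).2),
    ← det_flagMatrix_eq_of_staircase (natVar n) (δ := fun i => (core R β i : ℕ) + 1)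
      (nextCritical R β) (le_nextCritical R β),
    -- `flagMatrix` has the parts along its rows, the stated matrix along its columns.
    ← det_homSeries_eq_det_flagMatrix, ← Matrix.det_transpose]
  · congr 1
    ext1 i j
    exact (completeHomogeneous_eq_intCoeff _ _ _).symm
  · intro j
    have h1 := hupper j
    have h2 := hnext j
    have h3 := hcore j
    omega
  · intro i j hij hj
    refine ⟨by simp only [nextCritical_eq_of_le hij hj], ?_⟩
    exact eq_of_sameCarrel hij ((sameCarrel_nextCritical i).mono le_rfl hj)
  · intro i
    have h3 := hcore i
    beta_reduce
    omega
  · intro i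
    have h3 := hcore i
    beta_reduce
    omega
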